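/- **Theorem 1 (Vanishing error for nominal systems).** Consider the nominal mechanical system $$\bar M(q,t)\ddot q+\bar C(q,\dot q,t)\dot q+\bar g(q,t)=\bar B(q,t)\tau,\qquad q\in\mathbb R^n,\ \tau\in\mathbb R^m,\ m\le n,$$ with $\bar M(q,t)$ positive definite. Let $s_1<\dots<s_m$ be indices in $\{1,\dots,n\}$ and let $A\in\mathbb R^{m\times n}$ be the matrix with $Aq=(q_{s_1},\dots,q_{s_m})^\top$; put $\zeta=Aq$. Let the desired path be $\mathcal P=\{\zeta\in\mathbb R^m:\psi_i(\zeta)=0,\ i=1,\dots,m-1\}$, parameterized by $\mathcal P=\{(f_1(w),\dots,f_m(w)):w\in\mathbb R\}$ with $f_i\in C^2$ and $f_i'$ bounded; the path may be closed or self-intersecting. For $\xi=(\zeta,w)\in\mathbb R^{m+1}$ let $\phi_i(\xi)=\zeta_i-f_i(w)$, $\phi=(\phi_1,\dots,\phi_m)^\top$ and $\mathcal P^{hgh}=\{\xi:\phi(\xi)=0\}$. For gains $k_i>0$ let $$\chi^{\rm s}_i(\zeta,w)=(-1)^m f_i'(w)-k_i\phi_i(\xi),\quad i=1,\dots,m,\qquad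 \dot w=(-1)^m+\sum_{i=1}^m k_i\phi_i(\xi)f_i'(w),$$ where the second equation, with $\zeta=Aq$, governs the virtual coordinate $w$. Let $$\beta(q,\dot q,w)=A\dot q-\chi^{\rm s}(Aq,w),\qquad b(q,\dot q,w)=\frac{\partial \chi^{\rm s}(Aq,w)}{\partial q}\dot q+\frac{\partial\chi^{\rm s}(Aq,w)}{\partial w}\Big[(-1)^m+\sum_{i=1}^m k_i\phi_i(\xi)f_i'(w)\Big].$$ Let $P\in\mathbb R^{m\times m}$ be symmetric positive definite, $\kappa>0$, and let the control be $\tau=p_1+p_2$ with $$p_1=(A\bar M^{-1}\bar B)^{-1}\big[b+A\bar M^{-1}(\bar C\dot q+\bar g)\big],\qquad p_2=-\kappa(A\bar M^{-1}\bar B)^\top P\beta .$$ Assume that for every symmetric positive definite $P'\in\mathbb R^{m\times m}$ there is $\underline\lambda>0$ such that the smallest eigenvalue of $P'A\bar M^{-1}\bar B(A\bar M^{-1}\bar B)^\top P'$ is at least $\underline\lambda$ for all $q\in\mathbb R^n$ and $t\ge 0$. Then there are constants $c,\alpha>0$ such that, for every $t_0\ge 0$ and every solution $(q(t),\dot q(t),w(t))$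 of the closed loop on $[t_0,\infty)$ which satisfies, with $\xi(t)=(Aq(t),w(t))$, $$\inf\{\|\phi(\xi(t))\|:t\ge t_0,\ \mathrm{dist}(\xi(t),\mathcal P^{hgh})\ge\epsilon\}>0\quad\text{for all }\epsilon>0\qquad(\inf\emptyset=\infty),$$ the error $\beta(t)=\beta(q(t),\dot q(t),w(t))$ satisfies $\|\beta(t)\|\le c\,\|\beta(t_0)\|e^{-\alpha(t-t_0)}$ for all $t\ge t_0$, and the path-following error $\mathrm{dist}(\zeta(t),\mathcal P)$, where $\zeta(t)=Aq(t)$, tends to $0$ as $t\to\infty$. -/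

import Mathlib

open scoped Matrix Topology

noncomputable section

namespace VFCFC

/-- A nominal mechanical system `M(q,t) q̈ + C(q,q̇,t) q̇ + g(q,t) = B(q,t) τ` with configuration
`q ∈ ℝⁿ`, input `τ ∈ ℝᵐ` and positive definite inertia matrix. -/
structure NominalSystem (n m : ℕ) where
  M : (Fin n → ℝ) → ℝ → Matrix (Fin n) (Fin n) ℝ
  C : (Fin n → ℝ) → (Fin n → ℝ) → ℝ → Matrix (Fin n) (Fin n) ℝ
  g : (Fin n → ℝ) → ℝ → (Fin n → ℝ)
  B : (Fin n → ℝ) → ℝ → Matrix (Fin n) (Fin m) ℝ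
  posDef : ∀ q t, 0 ≤ t → (M q t).PosDef

/-- A desired path in `ℝᵐ`, given as the intersection of the zero sets of `m - 1` functions `ψ i`
and parameterized by `C²` functions `f i` with bounded derivatives. No injectivity is required of
the parameterization, so the path may be closed or self-intersecting. -/
structure DesiredPath (m : ℕ) where
  ψ : Fin (m - 1) → EuclideanSpace ℝ (Fin m) → ℝ
  f : Fin m → ℝ → ℝ
  contDiff : ∀ i, ContDiff ℝ 2 (f i)
  deriv_bounded : ∃ ε : ℝ, 0 < ε ∧ ∀ i w, |deriv (f i) w| ≤ ε
  parameterized : {ζ | ∀ i, ψ i ζ = 0} = Set.range fun w : ℝ => WithLp.toLp 2 fun i => f i w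

variable {n m : ℕ}

/-- The desired path `𝒫 = {ζ ∈ ℝᵐ : ψ₁(ζ) = ⋯ = ψₘ₋₁(ζ) = 0}`. -/
def DesiredPath.carrier (Γ : DesiredPath m) : Set (EuclideanSpace ℝ (Fin m)) :=
  {ζ | ∀ i, Γ.ψ i ζ = 0}

/-- The extended coordinate `ξ = (ζ, w) ∈ ℝᵐ⁺¹`. -/
def extend (ζ : Fin m → ℝ) (w : ℝ) : EuclideanSpace ℝ (Fin (m + 1)) :=
  WithLp.toLp 2 (Fin.snoc (α := fun _ => ℝ) ζ w)

/-- The path functions `φᵢ(ξ) = ζᵢ - fᵢ(w)`, collected in a vector of `ℝᵐ`. -/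
def DesiredPath.phi (Γ : DesiredPath m) (ξ : EuclideanSpace ℝ (Fin (m + 1))) :
    EuclideanSpace ℝ (Fin m) :=
  WithLp.toLp 2 fun i => ξ i.castSucc - Γ.f i (ξ (Fin.last m))

/-- The higher-dimensional path `{ξ ∈ ℝᵐ⁺¹ : φ₁(ξ) = ⋯ = φₘ(ξ) = 0}`. -/
def DesiredPath.high (Γ : DesiredPath m) : Set (EuclideanSpace ℝ (Fin (m + 1))) :=
  {ξ | ∀ i, Γ.phi ξ i = 0}

/-- The first `m` components `χˢ` of the guiding vector field, with gains `k`. -/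
def DesiredPath.chiS (Γ : DesiredPath m) (k : Fin m → ℝ) (ζ : Fin m → ℝ) (w : ℝ) : Fin m → ℝ :=
  fun i => (-1) ^ m * deriv (Γ.f i) w - k i * Γ.phi (extend ζ w) i

/-- The last component of the guiding vector field, which drives the virtual coordinate `w`. -/
def DesiredPath.chiW (Γ : DesiredPath m) (k : Fin m → ℝ) (ζ : Fin m → ℝ) (w : ℝ) : ℝ :=
  (-1) ^ m + ∑ i, k i * Γ.phi (extend ζ w) i * deriv (Γ.f i) w

/-- The `m × n` matrix `A` with `A q = (q_{s₁}, …, q_{sₘ})`, for indices `s₁ < ⋯ < sₘ`. -/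
def selection (s : Fin m ↪o Fin n) : Matrix (Fin m) (Fin n) ℝ :=
  Matrix.of fun i j => if s i = j then 1 else 0

/-- The error `β(q, q̇, w) = A q̇ - χˢ(A q, w)`. -/
def beta (s : Fin m ↪o Fin n) (Γ : DesiredPath m) (k : Fin m → ℝ)
    (q v : Fin n → ℝ) (w : ℝ) : Fin m → ℝ :=
  selection s *ᵥ v - Γ.chiS k (selection s *ᵥ q) w

/-- `b(q, q̇, w) = (∂χˢ/∂q) q̇ + (∂χˢ/∂w) ẇ`, where `χˢ` is evaluated at `(A q, w)` and `ẇ` is the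
last component of the guiding vector field. -/
def bTerm (s : Fin m ↪o Fin n) (Γ : DesiredPath m) (k : Fin m → ℝ)
    (q v : Fin n → ℝ) (w : ℝ) : Fin m → ℝ :=
  fderiv ℝ (fun q' : Fin n → ℝ => Γ.chiS k (selection s *ᵥ q') w) q v
    + Γ.chiW k (selection s *ᵥ q) w •
        deriv (fun w' : ℝ => Γ.chiS k (selection s *ᵥ q) w') w

/-- The matrix `A M⁻¹(q,t) B(q,t)`. -/
def NominalSystem.inputMatrix (S : NominalSystem n m) (s : Fin m ↪o Fin n)
    (q : Fin n → ℝ) (t : ℝ) : Matrix (Fin m) (Fin m) ℝ :=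
  selection s * (S.M q t)⁻¹ * S.B q t

/-- The feedforward part `p₁` of the nominal control. -/
def NominalSystem.p₁ (S : NominalSystem n m) (s : Fin m ↪o Fin n) (Γ : DesiredPath m)
    (k : Fin m → ℝ) (q v : Fin n → ℝ) (w t : ℝ) : Fin m → ℝ :=
  (S.inputMatrix s q t)⁻¹ *ᵥ
    (bTerm s Γ k q v w + (selection s * (S.M q t)⁻¹) *ᵥ (S.C q v t *ᵥ v + S.g q t))

/-- The feedback part `p₂` of the nominal control. -/
def NominalSystem.p₂ (S : NominalSystem n m) (s : Fin m ↪o Fin n) (Γ : DesiredPath m)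
    (k : Fin m → ℝ) (P : Matrix (Fin m) (Fin m) ℝ) (κ : ℝ)
    (q v : Fin n → ℝ) (w t : ℝ) : Fin m → ℝ :=
  -(κ • (((S.inputMatrix s q t)ᵀ * P) *ᵥ beta s Γ k q v w))

/-- For each positive definite `P`, the eigenvalues of `P (A M⁻¹ B) (A M⁻¹ B)ᵀ P` are bounded below
by a positive constant, uniformly in `q ∈ ℝⁿ` and `t ≥ 0`. -/
def NominalSystem.UniformlyActuated (S : NominalSystem n m) (s : Fin m ↪o Fin n) : Prop :=
  ∀ P : Matrix (Fin m) (Fin m) ℝ, P.PosDef →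
    ∃ l : ℝ, 0 < l ∧ ∀ q t, 0 ≤ t →
      ∀ μ ∈ spectrum ℝ (P * S.inputMatrix s q t * (S.inputMatrix s q t)ᵀ * P), l ≤ μ

/-- Along the curve `ξ(t)`, `t ≥ t₀`: for every `ε > 0`, the infimum of `‖φ(ξ(t))‖` over the times
with `dist(ξ(t), 𝒫ʰᵍʰ) ≥ ε` is positive. It is taken in `[0, ∞]`, so that it is `∞` when there is no
such time. -/
def DesiredPath.PhiSeparated (Γ : DesiredPath m) (t₀ : ℝ)
    (ξ : ℝ → EuclideanSpace ℝ (Fin (m + 1))) : Prop :=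
  ∀ ε : ℝ, 0 < ε →
    0 < ⨅ t ∈ {t : ℝ | t₀ ≤ t ∧ ε ≤ Metric.infDist (ξ t) Γ.high}, ‖Γ.phi (ξ t)‖ₑ

/-- `(q, v, w)` is a solution on `[t₀, ∞)`, with velocity `v = q̇` and acceleration `a = q̈`, of the
nominal system under the control `τ = p₁ + p₂`, coupled with the virtual system for `w`.
The derivatives at `t₀` are one-sided. -/
structure NominalSystem.IsClosedLoopSolution (S : NominalSystem n m) (s : Fin m ↪o Fin n)
    (Γ : DesiredPath m) (k : Fin m → ℝ) (P : Matrix (Fin m) (Fin m) ℝ) (κ t₀ : ℝ)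
    (q v a : ℝ → Fin n → ℝ) (w : ℝ → ℝ) : Prop where
  hasDeriv_q : ∀ t, t₀ ≤ t → HasDerivWithinAt q (v t) (Set.Ici t₀) t
  hasDeriv_v : ∀ t, t₀ ≤ t → HasDerivWithinAt v (a t) (Set.Ici t₀) t
  dynamics : ∀ t, t₀ ≤ t →
    S.M (q t) t *ᵥ a t + S.C (q t) (v t) t *ᵥ v t + S.g (q t) t
      = S.B (q t) t *ᵥ (S.p₁ s Γ k (q t) (v t) (w t) t + S.p₂ s Γ k P κ (q t) (v t) (w t) t)
  hasDeriv_w : ∀ t, t₀ ≤ t →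
    HasDerivWithinAt w (Γ.chiW k (selection s *ᵥ q t) (w t)) (Set.Ici t₀) t

end VFCFC

end

/-!
The control cancels the drift terms of the system, so that along the closed loop
`β' = -κ D Dᵀ P β` with `D = A M⁻¹ B`. Hence `U = βᵀ P β` satisfies
`U' = -2 κ βᵀ P D Dᵀ P β ≤ -2 κ l ‖β‖²`, where `l` is the uniform lower bound of the spectrum of
`P D Dᵀ P`, and since `U` is equivalent to `‖β‖²`, Gronwall's inequality gives the exponential
estimate.

For the path error, `φᵢ' = βᵢ - kᵢ φᵢ - fᵢ' ∑ⱼ kⱼ φⱼ fⱼ'`, because the propagation terms `(-1)ᵐ fᵢ'`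
of the guiding vector field cancel. With `V = ½ ∑ kᵢ φᵢ²` this gives
`V' = ∑ kᵢ φᵢ βᵢ - ∑ kᵢ² φᵢ² - (∑ kᵢ φᵢ fᵢ')² ≤ -(min k) V + ½ ‖β‖²`
(`exists_hasDerivWithinAt_pathEnergy`). So `V + U / (κ l)` is a strict Lyapunov function, which decays
exponentially, and `φ → 0`. As `f(w)` is a point of the path, `dist(ζ, 𝒫) ≤ ‖φ(ζ, w)‖ → 0`.
-/

namespace VFCFC

variable {n m : ℕ}

/-! ### Spectral bounds for quadratic forms -/

lemma exists_pos_le_of_forall_pos {ι : Type*} [Finite ι] (x : ι → ℝ) (hx : ∀ i, 0 < x i) :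
    ∃ δ : ℝ, 0 < δ ∧ ∀ i, δ ≤ x i := by
  rcases isEmpty_or_nonempty ι with _ | _
  · exact ⟨1, one_pos, fun i => isEmptyElim i⟩
  · obtain ⟨i₀, h₀⟩ := Finite.exists_min x
    exact ⟨x i₀, hx i₀, h₀⟩

/-- The Rayleigh quotient of a symmetric matrix is at least any lower bound of its spectrum. -/
lemma mul_dotProduct_self_le_of_spectrum {N : Matrix (Fin m) (Fin m) ℝ} (hN : N.IsHermitian)
    {l : ℝ} (hl : ∀ μ ∈ spectrum ℝ N, l ≤ μ) (x : Fin m → ℝ) :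
    l * (x ⬝ᵥ x) ≤ x ⬝ᵥ N *ᵥ x := by
  have hpsd : (N - algebraMap ℝ (Matrix (Fin m) (Fin m) ℝ) l).PosSemidef := by
    rw [Matrix.posSemidef_iff_isHermitian_and_spectrum_nonneg]
    refine ⟨hN.sub ?_, ?_⟩
    · rw [Algebra.algebraMap_eq_smul_one]
      simp [Matrix.IsHermitian]
    · intro μ hμ
      rw [← spectrum.sub_singleton_eq] at hμ
      obtain ⟨ν, hν, _, rfl, rfl⟩ := hμ
      exact sub_nonneg.2 (hl ν hν)
  have h := hpsd.dotProduct_mulVec_nonneg x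
  rw [Algebra.algebraMap_eq_smul_one, Matrix.sub_mulVec, Matrix.smul_mulVec, Matrix.one_mulVec,
    dotProduct_sub, dotProduct_smul] at h
  simp only [star_trivial, smul_eq_mul] at h
  linarith

/-- A positive definite quadratic form is equivalent to the squared Euclidean norm. -/
lemma _root_.Matrix.PosDef.exists_dotProduct_bounds {P : Matrix (Fin m) (Fin m) ℝ}
    (hP : P.PosDef) :
    ∃ p₁ p₂ : ℝ, 0 < p₁ ∧ 0 < p₂ ∧
      ∀ x, p₁ * (x ⬝ᵥ x) ≤ x ⬝ᵥ P *ᵥ x ∧ x ⬝ᵥ P *ᵥ x ≤ p₂ * (x ⬝ᵥ x) := by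
  have hH := hP.isHermitian
  obtain ⟨p₁, hp₁, h₁⟩ := exists_pos_le_of_forall_pos _ hP.eigenvalues_pos
  have h₂ : ∀ i, hH.eigenvalues i ≤ 1 + ∑ j, hH.eigenvalues j := fun i => by
    have := Finset.single_le_sum (f := hH.eigenvalues)
      (fun j _ => (hP.eigenvalues_pos j).le) (Finset.mem_univ i)
    linarith
  refine ⟨p₁, 1 + ∑ j, hH.eigenvalues j, hp₁, ?_, fun x => ⟨?_, ?_⟩⟩
  · have := Finset.sum_nonneg (s := Finset.univ) (fun j _ => (hP.eigenvalues_pos j).le)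
    linarith
  · refine mul_dotProduct_self_le_of_spectrum hH (fun μ hμ => ?_) x
    rw [hH.spectrum_real_eq_range_eigenvalues] at hμ
    obtain ⟨i, rfl⟩ := hμ
    exact h₁ i
  · have h := mul_dotProduct_self_le_of_spectrum (N := -P) (l := -(1 + ∑ j, hH.eigenvalues j))
      hH.neg (fun μ hμ => ?_) x
    · rw [Matrix.neg_mulVec, dotProduct_neg] at h
      linarith
    · rw [← spectrum.neg_eq, Set.mem_neg, hH.spectrum_real_eq_range_eigenvalues] at hμ
      obtain ⟨i, hi⟩ := hμ
      linarith [h₂ i]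

/-! ### Differential inequalities and derivatives along curves -/

/-- Gronwall's inequality on a half-line, for one-sided derivatives at the initial time. -/
lemma le_mul_exp_of_hasDerivWithinAt_Ici {V V' : ℝ → ℝ} {t₀ c : ℝ}
    (hV : ∀ t, t₀ ≤ t → HasDerivWithinAt V (V' t) (Set.Ici t₀) t)
    (hle : ∀ t, t₀ ≤ t → V' t ≤ -c * V t) {t : ℝ} (ht : t₀ ≤ t) :
    V t ≤ V t₀ * Real.exp (-c * (t - t₀)) := by
  have hW : ∀ s, t₀ ≤ s → HasDerivWithinAt (fun s => V s * Real.exp (c * (s - t₀)))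
      (V' s * Real.exp (c * (s - t₀)) + V s * (Real.exp (c * (s - t₀)) * c)) (Set.Ici t₀) s := by
    intro s hs
    refine (hV s hs).mul (HasDerivAt.hasDerivWithinAt ?_)
    have h : HasDerivAt (fun s => c * (s - t₀)) c s := by
      simpa using ((hasDerivAt_id s).sub_const t₀).const_mul c
    exact h.exp
  have hanti : AntitoneOn (fun s => V s * Real.exp (c * (s - t₀))) (Set.Ici t₀) := by
    refine antitoneOn_of_hasDerivWithinAt_nonpos (convex_Ici t₀)
      (fun s hs => (hW s hs).continuousWithinAt)
      (fun s hs => (hW s (interior_subset hs)).mono interior_subset) (fun s hs => ?_)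
    have h := hle s (interior_subset hs)
    have he := Real.exp_pos (c * (s - t₀))
    nlinarith
  have h := hanti (Set.mem_Ici.2 le_rfl) (Set.mem_Ici.2 ht) ht
  simp only [sub_self, mul_zero, Real.exp_zero, mul_one] at h
  calc V t = V t * Real.exp (c * (t - t₀)) * Real.exp (-c * (t - t₀)) := by
        rw [mul_assoc, ← Real.exp_add]; simp
    _ ≤ _ := mul_le_mul_of_nonneg_right h (Real.exp_pos _).le

lemma hasDerivWithinAt_mulVec {ι κ : Type*} [Fintype ι] [Fintype κ] (A : Matrix ι κ ℝ)
    {x : ℝ → κ → ℝ} {x' : κ → ℝ} {s : Set ℝ} {t : ℝ} (hx : HasDerivWithinAt x x' s t) :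
    HasDerivWithinAt (fun t => A *ᵥ x t) (A *ᵥ x') s t :=
  (Matrix.mulVecLin A).toContinuousLinearMap.hasFDerivAt.comp_hasDerivWithinAt t hx

lemma hasDerivWithinAt_quadraticForm {P : Matrix (Fin m) (Fin m) ℝ} (hP : P.IsHermitian)
    {x : ℝ → Fin m → ℝ} {x' : Fin m → ℝ} {s : Set ℝ} {t : ℝ} (hx : HasDerivWithinAt x x' s t) :
    HasDerivWithinAt (fun t => x t ⬝ᵥ P *ᵥ x t) (2 * ((P *ᵥ x t) ⬝ᵥ x')) s t := by
  have h := HasDerivWithinAt.fun_sum (u := Finset.univ) fun i _ =>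
    (hasDerivWithinAt_pi.1 hx i).mul (hasDerivWithinAt_pi.1 (hasDerivWithinAt_mulVec P hx) i)
  refine h.congr_deriv ?_
  have hsymm : x t ⬝ᵥ P *ᵥ x' = (P *ᵥ x t) ⬝ᵥ x' := by
    have hT : Pᵀ = P := by
      rw [← Matrix.conjTranspose_eq_transpose_of_trivial]; exact hP
    rw [Matrix.dotProduct_mulVec, ← Matrix.mulVec_transpose, hT]
  rw [Finset.sum_add_distrib, two_mul]
  refine congrArg₂ (· + ·) ?_ hsymm
  exact dotProduct_comm _ _

/-! ### The guiding vector field -/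

lemma DesiredPath.phi_extend (Γ : DesiredPath m) (ζ : Fin m → ℝ) (w : ℝ) (i : Fin m) :
    Γ.phi (extend ζ w) i = ζ i - Γ.f i w := by
  simp [DesiredPath.phi, extend]

lemma DesiredPath.hasDerivAt_f (Γ : DesiredPath m) (i : Fin m) (w : ℝ) :
    HasDerivAt (Γ.f i) (deriv (Γ.f i) w) w :=
  ((Γ.contDiff i).differentiable (by norm_num) w).hasDerivAt

lemma DesiredPath.hasDerivAt_deriv_f (Γ : DesiredPath m) (i : Fin m) (w : ℝ) :
    HasDerivAt (deriv (Γ.f i)) (deriv (deriv (Γ.f i)) w) w := by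
  have h : ContDiff ℝ (1 + 1) (Γ.f i) := by
    rw [one_add_one_eq_two]; exact Γ.contDiff i
  exact ((contDiff_succ_iff_deriv.1 h).2.2.differentiable (by norm_num) w).hasDerivAt

lemma bTerm_apply (s : Fin m ↪o Fin n) (Γ : DesiredPath m) (k : Fin m → ℝ)
    (q v : Fin n → ℝ) (w : ℝ) (i : Fin m) :
    bTerm s Γ k q v w i = -(k i * (selection s *ᵥ v) i) +
      Γ.chiW k (selection s *ᵥ q) w *
        ((-1) ^ m * deriv (deriv (Γ.f i)) w + k i * deriv (Γ.f i) w) := by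
  have hq : HasFDerivAt (fun q' : Fin n → ℝ => Γ.chiS k (selection s *ᵥ q') w)
      (ContinuousLinearMap.pi fun i => -(k i • (ContinuousLinearMap.proj (R := ℝ) i ∘L
        (Matrix.mulVecLin (selection s)).toContinuousLinearMap))) q := by
    refine hasFDerivAt_pi.2 fun i => ?_
    simp only [DesiredPath.chiS, DesiredPath.phi_extend]
    exact (((ContinuousLinearMap.proj (R := ℝ) i ∘L
      (Matrix.mulVecLin (selection s)).toContinuousLinearMap).hasFDerivAt.sub_const
        (Γ.f i w)).const_mul (k i)).const_sub _
  have hw : HasDerivAt (fun w' : ℝ => Γ.chiS k (selection s *ᵥ q) w')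
      (fun i => (-1) ^ m * deriv (deriv (Γ.f i)) w + k i * deriv (Γ.f i) w) w := by
    refine hasDerivAt_pi.2 fun i => ?_
    simp only [DesiredPath.chiS, DesiredPath.phi_extend]
    refine (((Γ.hasDerivAt_deriv_f i w).const_mul _).sub
      (((Γ.hasDerivAt_f i w).const_sub _).const_mul (k i))).congr_deriv ?_
    ring
  rw [bTerm, hq.fderiv, hw.deriv]
  simp

/-! ### The error along the closed loop -/

/-- Uniform actuation is a coercivity estimate for `P D Dᵀ P`, and it makes the input matrix
`D = A M⁻¹ B` invertible. -/
lemma NominalSystem.UniformlyActuated.exists_coercive {S : NominalSystem n m} {s : Fin m ↪o Fin n}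
    (hS : S.UniformlyActuated s) {P : Matrix (Fin m) (Fin m) ℝ} (hP : P.PosDef) :
    ∃ l : ℝ, 0 < l ∧ ∀ q t, 0 ≤ t → IsUnit (S.inputMatrix s q t).det ∧
      ∀ x, l * (x ⬝ᵥ x) ≤
        x ⬝ᵥ (P * S.inputMatrix s q t * (S.inputMatrix s q t)ᵀ * P) *ᵥ x := by
  obtain ⟨l, hl, h⟩ := hS P hP
  refine ⟨l, hl, fun q t ht => ?_⟩
  set D := S.inputMatrix s q t
  have hT : Pᵀ = P := by
    rw [← Matrix.conjTranspose_eq_transpose_of_trivial]; exact hP.isHermitian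
  have hH : (P * D * Dᵀ * P).IsHermitian := by
    rw [Matrix.IsHermitian, Matrix.conjTranspose_eq_transpose_of_trivial]
    simp only [Matrix.transpose_mul, Matrix.transpose_transpose, hT, Matrix.mul_assoc]
  refine ⟨?_, fun x => mul_dotProduct_self_le_of_spectrum hH (h q t ht) x⟩
  have hunit : IsUnit (P * D * Dᵀ * P) := by
    refine spectrum.isUnit_of_zero_notMem ℝ fun h0 => ?_
    linarith [h q t ht 0 h0]
  rw [Matrix.isUnit_iff_isUnit_det, Matrix.det_mul, Matrix.det_mul, Matrix.det_mul] at hunit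
  exact isUnit_of_mul_isUnit_right
    (isUnit_of_mul_isUnit_left (isUnit_of_mul_isUnit_left hunit))

section ClosedLoop

variable {S : NominalSystem n m} {s : Fin m ↪o Fin n} {Γ : DesiredPath m} {k : Fin m → ℝ}
  {P : Matrix (Fin m) (Fin m) ℝ} {κ t₀ : ℝ} {q v a : ℝ → Fin n → ℝ} {w : ℝ → ℝ}

/-- Where `A M⁻¹ B` is invertible, `p₁` cancels the drift terms, so that
`A q̈ - b = -κ (A M⁻¹ B) (A M⁻¹ B)ᵀ P β`. -/
lemma NominalSystem.IsClosedLoopSolution.selection_mulVec_accel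
    (h : S.IsClosedLoopSolution s Γ k P κ t₀ q v a w) {t : ℝ} (h0 : 0 ≤ t) (ht : t₀ ≤ t)
    (hD : IsUnit (S.inputMatrix s (q t) t).det) :
    selection s *ᵥ a t = bTerm s Γ k (q t) (v t) (w t) +
      -(κ • ((S.inputMatrix s (q t) t * (S.inputMatrix s (q t) t)ᵀ * P) *ᵥ
        beta s Γ k (q t) (v t) (w t))) := by
  have hM : IsUnit (S.M (q t) t).det := by
    rw [← Matrix.isUnit_iff_isUnit_det]; exact (S.posDef (q t) t h0).isUnit
  have hdyn := h.dynamics t ht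
  set τ := S.p₁ s Γ k (q t) (v t) (w t) t + S.p₂ s Γ k P κ (q t) (v t) (w t) t with hτ
  have ha : a t = (S.M (q t) t)⁻¹ *ᵥ
      (S.B (q t) t *ᵥ τ - (S.C (q t) (v t) t *ᵥ v t + S.g (q t) t)) := by
    rw [← hdyn, add_assoc, add_sub_cancel_right, Matrix.mulVec_mulVec,
      Matrix.nonsing_inv_mul _ hM, Matrix.one_mulVec]
  have hDτ : S.inputMatrix s (q t) t *ᵥ τ = bTerm s Γ k (q t) (v t) (w t) +
      (selection s * (S.M (q t) t)⁻¹) *ᵥ (S.C (q t) (v t) t *ᵥ v t + S.g (q t) t) +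
      -(κ • ((S.inputMatrix s (q t) t * (S.inputMatrix s (q t) t)ᵀ * P) *ᵥ
        beta s Γ k (q t) (v t) (w t))) := by
    rw [hτ, Matrix.mulVec_add, NominalSystem.p₁, NominalSystem.p₂, Matrix.mulVec_mulVec,
      Matrix.mul_nonsing_inv _ hD, Matrix.one_mulVec, Matrix.mulVec_neg, Matrix.mulVec_smul,
      Matrix.mulVec_mulVec, Matrix.mul_assoc (S.inputMatrix s (q t) t)]
  have hDτ' : selection s *ᵥ (S.M (q t) t)⁻¹ *ᵥ S.B (q t) t *ᵥ τ =
      S.inputMatrix s (q t) t *ᵥ τ := by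
    simp only [NominalSystem.inputMatrix, Matrix.mulVec_mulVec, Matrix.mul_assoc]
  rw [ha, Matrix.mulVec_sub, Matrix.mulVec_sub, hDτ', hDτ, Matrix.mulVec_mulVec]
  abel

/-- Along the closed loop, `β` solves `β' = -κ (A M⁻¹ B) (A M⁻¹ B)ᵀ P β`. -/
lemma NominalSystem.IsClosedLoopSolution.hasDerivWithinAt_beta
    (h : S.IsClosedLoopSolution s Γ k P κ t₀ q v a w) {t : ℝ} (h0 : 0 ≤ t) (ht : t₀ ≤ t)
    (hD : IsUnit (S.inputMatrix s (q t) t).det) :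
    HasDerivWithinAt (fun t => beta s Γ k (q t) (v t) (w t))
      (-(κ • ((S.inputMatrix s (q t) t * (S.inputMatrix s (q t) t)ᵀ * P) *ᵥ
        beta s Γ k (q t) (v t) (w t)))) (Set.Ici t₀) t := by
  have hw := h.hasDeriv_w t ht
  have hchi : HasDerivWithinAt (fun t => Γ.chiS k (selection s *ᵥ q t) (w t))
      (bTerm s Γ k (q t) (v t) (w t)) (Set.Ici t₀) t := by
    refine hasDerivWithinAt_pi.2 fun i => ?_
    simp only [DesiredPath.chiS, DesiredPath.phi_extend]
    have hq := hasDerivWithinAt_pi.1 (hasDerivWithinAt_mulVec (selection s) (h.hasDeriv_q t ht)) i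
    refine ((((Γ.hasDerivAt_deriv_f i (w t)).comp_hasDerivWithinAt t hw).const_mul _).sub
      ((hq.sub ((Γ.hasDerivAt_f i (w t)).comp_hasDerivWithinAt t hw)).const_mul
        (k i))).congr_deriv ?_
    rw [bTerm_apply]
    ring
  refine ((hasDerivWithinAt_mulVec (selection s) (h.hasDeriv_v t ht)).sub hchi).congr_deriv ?_
  rw [h.selection_mulVec_accel h0 ht hD, add_sub_cancel_left]

/-- The path functions satisfy `φᵢ' = βᵢ - kᵢ φᵢ - fᵢ' ∑ⱼ kⱼ φⱼ fⱼ'`: the propagation terms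
`(-1)ᵐ fᵢ'` of `χˢ` and of `fᵢ' ẇ` cancel. -/
lemma NominalSystem.IsClosedLoopSolution.hasDerivWithinAt_phi
    (h : S.IsClosedLoopSolution s Γ k P κ t₀ q v a w) {t : ℝ} (ht : t₀ ≤ t) (i : Fin m) :
    HasDerivWithinAt (fun t => Γ.phi (extend (selection s *ᵥ q t) (w t)) i)
      (beta s Γ k (q t) (v t) (w t) i - k i * Γ.phi (extend (selection s *ᵥ q t) (w t)) i
        - deriv (Γ.f i) (w t) *
          ∑ j, k j * Γ.phi (extend (selection s *ᵥ q t) (w t)) j * deriv (Γ.f j) (w t))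
      (Set.Ici t₀) t := by
  have hq := hasDerivWithinAt_pi.1 (hasDerivWithinAt_mulVec (selection s) (h.hasDeriv_q t ht)) i
  have hd := hq.sub ((Γ.hasDerivAt_f i (w t)).comp_hasDerivWithinAt t (h.hasDeriv_w t ht))
  have hfun : (fun t => Γ.phi (extend (selection s *ᵥ q t) (w t)) i) =
      fun t => (selection s *ᵥ q t) i - Γ.f i (w t) := by
    funext t; exact Γ.phi_extend _ _ i
  rw [hfun]
  refine hd.congr_deriv ?_
  simp only [beta, Pi.sub_apply, DesiredPath.chiS, DesiredPath.chiW]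
  ring

/-- The weighted path error `½ ∑ᵢ kᵢ φᵢ²` decreases at the rate `min k`, up to a term quadratic
in `β`. -/
lemma NominalSystem.IsClosedLoopSolution.exists_hasDerivWithinAt_pathEnergy
    (h : S.IsClosedLoopSolution s Γ k P κ t₀ q v a w) {k₀ : ℝ} (hk₀ : ∀ i, k₀ ≤ k i)
    (hk : ∀ i, 0 < k i) {t : ℝ} (ht : t₀ ≤ t) :
    ∃ d, HasDerivWithinAt
        (fun t => ∑ i, k i * Γ.phi (extend (selection s *ᵥ q t) (w t)) i ^ 2 / 2) d
        (Set.Ici t₀) t ∧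
      d ≤ -k₀ * (∑ i, k i * Γ.phi (extend (selection s *ᵥ q t) (w t)) i ^ 2 / 2) +
        (beta s Γ k (q t) (v t) (w t) ⬝ᵥ beta s Γ k (q t) (v t) (w t)) / 2 := by
  refine ⟨_, HasDerivWithinAt.fun_sum fun i _ =>
    (((h.hasDerivWithinAt_phi ht i).pow 2).const_mul (k i)).div_const 2, ?_⟩
  set φ : Fin m → ℝ := fun i => Γ.phi (extend (selection s *ᵥ q t) (w t)) i
  set β := beta s Γ k (q t) (v t) (w t)
  set f' : Fin m → ℝ := fun i => deriv (Γ.f i) (w t)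
  set σ := ∑ j, k j * φ j * f' j with hσ
  calc ∑ i, k i * (((2 : ℕ) : ℝ) * φ i ^ (2 - 1) * (β i - k i * φ i - f' i * σ)) / 2
      = ∑ i, (k i * φ i * β i - k i ^ 2 * φ i ^ 2) - σ * σ := by
        conv_rhs => rw [hσ, Finset.mul_sum, ← hσ, ← Finset.sum_sub_distrib]
        refine Finset.sum_congr rfl fun i _ => ?_
        push_cast
        ring
    _ ≤ ∑ i, (k i * φ i * β i - k i ^ 2 * φ i ^ 2) := by nlinarith [mul_self_nonneg σ]
    _ ≤ ∑ i, (-k₀ * (k i * φ i ^ 2 / 2) + β i * β i / 2) := by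
        refine Finset.sum_le_sum fun i _ => ?_
        have h1 : k₀ * (k i * φ i ^ 2) ≤ k i * (k i * φ i ^ 2) :=
          mul_le_mul_of_nonneg_right (hk₀ i) (mul_nonneg (hk i).le (sq_nonneg _))
        nlinarith [sq_nonneg (k i * φ i - β i)]
    _ = _ := by
        rw [Finset.sum_add_distrib, Finset.mul_sum, dotProduct, Finset.sum_div]

/-- The quadratic form `βᵀ P β` decreases at a rate proportional to `κ ‖β‖²`. -/
lemma NominalSystem.IsClosedLoopSolution.exists_hasDerivWithinAt_betaEnergy
    (h : S.IsClosedLoopSolution s Γ k P κ t₀ q v a w) (hP : P.IsHermitian) (hκ : 0 < κ) {l t : ℝ}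
    (h0 : 0 ≤ t) (ht : t₀ ≤ t) (hD : IsUnit (S.inputMatrix s (q t) t).det)
    (hl : ∀ x, l * (x ⬝ᵥ x) ≤
      x ⬝ᵥ (P * S.inputMatrix s (q t) t * (S.inputMatrix s (q t) t)ᵀ * P) *ᵥ x) :
    ∃ d, HasDerivWithinAt (fun t => beta s Γ k (q t) (v t) (w t) ⬝ᵥ
        P *ᵥ beta s Γ k (q t) (v t) (w t)) d (Set.Ici t₀) t ∧
      d ≤ -(2 * κ * l) *
        (beta s Γ k (q t) (v t) (w t) ⬝ᵥ beta s Γ k (q t) (v t) (w t)) := by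
  refine ⟨_, hasDerivWithinAt_quadraticForm hP (h.hasDerivWithinAt_beta h0 ht hD), ?_⟩
  have hl' := hl (beta s Γ k (q t) (v t) (w t))
  set β := beta s Γ k (q t) (v t) (w t)
  have hT : Pᵀ = P := by
    rw [← Matrix.conjTranspose_eq_transpose_of_trivial]; exact hP
  have he : (P *ᵥ β) ⬝ᵥ (S.inputMatrix s (q t) t * (S.inputMatrix s (q t) t)ᵀ * P) *ᵥ β =
      β ⬝ᵥ (P * S.inputMatrix s (q t) t * (S.inputMatrix s (q t) t)ᵀ * P) *ᵥ β := by
    conv_lhs => rw [← hT, Matrix.mulVec_transpose, ← Matrix.dotProduct_mulVec,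
      Matrix.mulVec_mulVec, hT]
    simp only [Matrix.mul_assoc]
  rw [dotProduct_neg, dotProduct_smul, smul_eq_mul, he]
  nlinarith

end ClosedLoop

/-! ### Convergence to the path -/

lemma norm_toLp_sq_eq_dotProduct (x : Fin m → ℝ) : ‖WithLp.toLp 2 x‖ ^ 2 = x ⬝ᵥ x := by
  rw [EuclideanSpace.real_norm_sq_eq, dotProduct]
  exact Finset.sum_congr rfl fun i _ => by simp [sq]

/-- The point `f(w)` lies on the path, at distance `‖φ(ζ, w)‖` from `ζ`. -/
lemma DesiredPath.infDist_carrier_le (Γ : DesiredPath m) (ζ : Fin m → ℝ) (w : ℝ) :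
    Metric.infDist (WithLp.toLp 2 ζ) Γ.carrier ≤ ‖Γ.phi (extend ζ w)‖ := by
  have hmem : (WithLp.toLp 2 fun i => Γ.f i w) ∈ Γ.carrier := by
    rw [DesiredPath.carrier, Γ.parameterized]
    exact ⟨w, rfl⟩
  refine (Metric.infDist_le_dist_of_mem hmem).trans_eq ?_
  rw [dist_eq_norm]
  congr 1
  ext i
  rw [Γ.phi_extend]
  rfl

end VFCFC

theorem theorem1 {n m : ℕ} (S : VFCFC.NominalSystem n m) (s : Fin m ↪o Fin n)
    (Γ : VFCFC.DesiredPath m) (k : Fin m → ℝ) (hk : ∀ i, 0 < k i)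
    (P : Matrix (Fin m) (Fin m) ℝ) (hP : P.PosDef) (κ : ℝ) (hκ : 0 < κ)
    (hS : S.UniformlyActuated s) :
    ∃ c α : ℝ, 0 < c ∧ 0 < α ∧
      ∀ (t₀ : ℝ) (q v a : ℝ → Fin n → ℝ) (w : ℝ → ℝ), 0 ≤ t₀ →
        S.IsClosedLoopSolution s Γ k P κ t₀ q v a w →
        Γ.PhiSeparated t₀ (fun t => VFCFC.extend (VFCFC.selection s *ᵥ q t) (w t)) →
        (∀ t, t₀ ≤ t →
          ‖WithLp.toLp 2 (VFCFC.beta s Γ k (q t) (v t) (w t))‖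
            ≤ c * ‖WithLp.toLp 2 (VFCFC.beta s Γ k (q t₀) (v t₀) (w t₀))‖
                * Real.exp (-α * (t - t₀))) ∧
        Filter.Tendsto
          (fun t => Metric.infDist (WithLp.toLp 2 (VFCFC.selection s *ᵥ q t)) Γ.carrier)
          Filter.atTop (𝓝 0) := by
  obtain ⟨p₁, p₂, hp₁, hp₂, hp⟩ := hP.exists_dotProduct_bounds
  obtain ⟨l, hl, hcoer⟩ := hS.exists_coercive hP
  obtain ⟨k₀, hk₀, hkk₀⟩ := VFCFC.exists_pos_le_of_forall_pos k hk
  have hκl : 0 < κ * l := mul_pos hκ hl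
  refine ⟨√(p₂ / p₁), κ * l / p₂, Real.sqrt_pos.2 (div_pos hp₂ hp₁), div_pos hκl hp₂, ?_⟩
  intro t₀ q v a w ht₀ hsol _
  set β : ℝ → Fin m → ℝ := fun t => VFCFC.beta s Γ k (q t) (v t) (w t)
  set φ : ℝ → EuclideanSpace ℝ (Fin m) :=
    fun t => Γ.phi (VFCFC.extend (VFCFC.selection s *ᵥ q t) (w t))
  have hU : ∀ t, ∃ d, t₀ ≤ t → HasDerivWithinAt (fun t => β t ⬝ᵥ P *ᵥ β t) d (Set.Ici t₀) t ∧
      d ≤ -(2 * κ * l) * (β t ⬝ᵥ β t) := by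
    intro t
    by_cases ht : t₀ ≤ t
    · obtain ⟨hD, hle⟩ := hcoer (q t) t (ht₀.trans ht)
      obtain ⟨d, hd⟩ := hsol.exists_hasDerivWithinAt_betaEnergy hP.isHermitian hκ
        (ht₀.trans ht) ht hD hle
      exact ⟨d, fun _ => hd⟩
    · exact ⟨0, fun h => absurd h ht⟩
  have hV : ∀ t, ∃ d, t₀ ≤ t →
      HasDerivWithinAt (fun t => ∑ i, k i * φ t i ^ 2 / 2) d (Set.Ici t₀) t ∧
      d ≤ -k₀ * (∑ i, k i * φ t i ^ 2 / 2) + (β t ⬝ᵥ β t) / 2 := by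
    intro t
    by_cases ht : t₀ ≤ t
    · obtain ⟨d, hd⟩ := hsol.exists_hasDerivWithinAt_pathEnergy hkk₀ hk ht
      exact ⟨d, fun _ => hd⟩
    · exact ⟨0, fun h => absurd h ht⟩
  choose dU hU using hU
  choose dV hV using hV
  have hU_le : ∀ t, κ * l / p₂ * (β t ⬝ᵥ P *ᵥ β t) ≤ κ * l * (β t ⬝ᵥ β t) := fun t => by
    rw [div_mul_eq_mul_div, div_le_iff₀ hp₂]
    nlinarith [(hp (β t)).2]
  have hβ_nonneg : ∀ t, 0 ≤ β t ⬝ᵥ β t := fun t => by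
    rw [← VFCFC.norm_toLp_sq_eq_dotProduct]
    positivity
  have hU_nonneg : ∀ t, 0 ≤ β t ⬝ᵥ P *ᵥ β t := fun t =>
    (mul_nonneg hp₁.le (hβ_nonneg t)).trans (hp (β t)).1
  have hV_nonneg : ∀ t, 0 ≤ ∑ i, k i * φ t i ^ 2 / 2 := fun t =>
    Finset.sum_nonneg fun i _ => div_nonneg (mul_nonneg (hk i).le (sq_nonneg _)) two_pos.le
  constructor
  · intro t ht
    have hexp : β t ⬝ᵥ P *ᵥ β t ≤
        (β t₀ ⬝ᵥ P *ᵥ β t₀) * Real.exp (-(2 * (κ * l / p₂)) * (t - t₀)) := by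
      refine VFCFC.le_mul_exp_of_hasDerivWithinAt_Ici (fun t ht => (hU t ht).1)
        (fun t ht => (hU t ht).2.trans ?_) ht
      linarith [hU_le t]
    change ‖WithLp.toLp 2 (β t)‖ ≤ _ * ‖WithLp.toLp 2 (β t₀)‖ * _
    refine le_of_sq_le_sq ?_ (by positivity)
    have he : Real.exp (-(2 * (κ * l / p₂)) * (t - t₀)) =
        Real.exp (-(κ * l / p₂) * (t - t₀)) ^ 2 := by
      rw [← Real.exp_nat_mul]; congr 1; push_cast; ring
    rw [mul_pow, mul_pow, Real.sq_sqrt (div_pos hp₂ hp₁).le, VFCFC.norm_toLp_sq_eq_dotProduct,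
      VFCFC.norm_toLp_sq_eq_dotProduct, ← he, div_mul_eq_mul_div, div_mul_eq_mul_div,
      le_div_iff₀ hp₁]
    calc (β t ⬝ᵥ β t) * p₁ ≤ β t ⬝ᵥ P *ᵥ β t := by linarith [(hp (β t)).1]
      _ ≤ _ := hexp
      _ ≤ _ := mul_le_mul_of_nonneg_right (hp (β t₀)).2 (Real.exp_pos _).le
  · set c := min k₀ (κ * l / p₂)
    have hc_pos : 0 < c := lt_min hk₀ (div_pos hκl hp₂)
    -- With the weight `1 / (κ l)`, the decrease `-2 ‖β‖²` of the second summand absorbs the term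
    -- `‖β‖² / 2` in the derivative of the first and leaves enough for exponential decay.
    set W : ℝ → ℝ := fun t => (∑ i, k i * φ t i ^ 2 / 2) + (β t ⬝ᵥ P *ᵥ β t) / (κ * l) with hW
    have hW_le : ∀ t, t₀ ≤ t → W t ≤ W t₀ * Real.exp (-c * (t - t₀)) := by
      intro t ht
      refine VFCFC.le_mul_exp_of_hasDerivWithinAt_Ici
        (fun t ht => (hV t ht).1.add ((hU t ht).1.div_const (κ * l))) (fun t ht => ?_) ht
      have h1 : dU t / (κ * l) ≤ -(2 * (β t ⬝ᵥ β t)) := by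
        rw [div_le_iff₀ hκl]; linarith [(hU t ht).2]
      have h2 : c * ((β t ⬝ᵥ P *ᵥ β t) / (κ * l)) ≤ β t ⬝ᵥ β t := by
        rw [← mul_div_assoc, div_le_iff₀ hκl]
        have := mul_le_mul_of_nonneg_right (min_le_right k₀ (κ * l / p₂)) (hU_nonneg t)
        linarith [hU_le t]
      have h3 := mul_le_mul_of_nonneg_right (min_le_left k₀ (κ * l / p₂)) (hV_nonneg t)
      change _ ≤ -c * ((∑ i, k i * φ t i ^ 2 / 2) + (β t ⬝ᵥ P *ᵥ β t) / (κ * l))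
      linarith [(hV t ht).2, hβ_nonneg t]
    have hφ_le : ∀ t, t₀ ≤ t → ‖φ t‖ ≤ √(2 / k₀ * (W t₀ * Real.exp (-c * (t - t₀)))) := by
      intro t ht
      refine Real.le_sqrt_of_sq_le ?_
      have h1 : ‖φ t‖ ^ 2 ≤ 2 / k₀ * W t := by
        rw [EuclideanSpace.real_norm_sq_eq, div_mul_eq_mul_div, le_div_iff₀ hk₀, Finset.sum_mul]
        have h2 : ∑ i, φ t i ^ 2 * k₀ ≤ 2 * ∑ i, k i * φ t i ^ 2 / 2 := by
          rw [Finset.mul_sum]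
          exact Finset.sum_le_sum fun i _ => by nlinarith [hkk₀ i, sq_nonneg (φ t i)]
        have h3 := div_nonneg (hU_nonneg t) hκl.le
        rw [hW]
        linarith
      exact h1.trans (mul_le_mul_of_nonneg_left (hW_le t ht) (by positivity))
    have hlim : Filter.Tendsto (fun t => √(2 / k₀ * (W t₀ * Real.exp (-c * (t - t₀)))))
        Filter.atTop (𝓝 0) := by
      have h1 : Filter.Tendsto (fun t => Real.exp (-c * (t - t₀))) Filter.atTop (𝓝 0) :=
        Real.tendsto_exp_atBot.comp (Filter.Tendsto.const_mul_atTop_of_neg (neg_neg_of_pos hc_pos)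
          (Filter.tendsto_atTop_add_const_right _ _ Filter.tendsto_id))
      simpa using ((h1.const_mul (W t₀)).const_mul (2 / k₀)).sqrt
    refine squeeze_zero' (Filter.Eventually.of_forall fun _ => Metric.infDist_nonneg) ?_ hlim
    filter_upwards [Filter.eventually_ge_atTop t₀] with t ht
    exact (Γ.infDist_carrier_le _ (w t)).trans (hφ_le t ht)
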